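/- Let $k\ge 1$, let $\mathbb D$ be the open unit disc of $\mathbb C$ and $\overline{\mathbb D}$ the closed one. Let $A^+(\mathbb T^k)$ be the algebra (under pointwise operations) of the functions $f\colon \overline{\mathbb D}^k\to\mathbb C$ that can be written as $f(z)=\sum_{n\in\mathbb N_0^k} a(n)\, z_1^{n_1}\cdots z_k^{n_k}$ with $\|f\|_{A^+(\mathbb T^k)}=\sum_{n}|a(n)|<\infty$. Assume that the map $\varphi\colon \mathbb D^k\to\overline{\mathbb D}^k$ induces a bounded composition operator $C_\varphi\colon A^+(\mathbb T^k)\to A^+(\mathbb T^k)$; that is, for every $f\in A^+(\mathbb T^k)$ the function $f\circ\varphi$ on $\mathbb D^k$ extends to a (necessarily unique) element $C_\varphi f$ of $A^+(\mathbb T^k)$, and there is a constant $C$ with $\|C_\varphi f\|_{A^+(\mathbb T^k)}\le C\|f\|_{A^+(\mathbb T^k)}$ for all $f$. Then $C_\varphi$ is an automorphism of the algebra $A^+(\mathbb T^k)$ if and only if there are a permutation $\sigma$ of $\{1,\dots,k\}$ and complex numbers $\varepsilon_1,\dots,\varepsilon_k$ of modulus $1$ such that $\varphi(z)=(\varepsilon_1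 z_{\sigma(1)},\dots,\varepsilon_k z_{\sigma(k)})$ for all $z\in\mathbb D^k$. -/

import Mathlib

/-- The open unit polydisc `𝔻^k`. -/
def polydisc (k : ℕ) : Set (Fin k → ℂ) := {z | ∀ i, ‖z i‖ < 1}

/-- The closed unit polydisc. -/
def closedPolydisc (k : ℕ) : Set (Fin k → ℂ) := {z | ∀ i, ‖z i‖ ≤ 1}

namespace WienerPlus

/-- The inclusion of the open polydisc in the closed one. -/
def incl {k : ℕ} (z : polydisc k) : closedPolydisc k := ⟨z.1, fun i => (z.2 i).le⟩

/-- The monomial `z₁^{n₁} ⋯ z_k^{n_k}`. -/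
def monomial {k : ℕ} (n : Fin k → ℕ) (z : closedPolydisc k) : ℂ := ∏ i, z.1 i ^ n i

/-- `f(z) = ∑ a(n) z^n` on the closed polydisc, with `∑ |a(n)| < ∞`. -/
def Represents {k : ℕ} (a : (Fin k → ℕ) → ℂ) (f : closedPolydisc k → ℂ) : Prop :=
  Summable (fun n => ‖a n‖) ∧ ∀ z, HasSum (fun n => a n * monomial n z) (f z)

theorem norm_monomial_le {k : ℕ} (n : Fin k → ℕ) (z : closedPolydisc k) :
    ‖monomial n z‖ ≤ 1 := by
  rw [monomial, norm_prod]
  refine Finset.prod_le_one (fun i _ => norm_nonneg _) (fun i _ => ?_)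
  rw [norm_pow]
  exact pow_le_one₀ (norm_nonneg _) (z.2 i)

theorem norm_term_le {k : ℕ} (a : (Fin k → ℕ) → ℂ) (n : Fin k → ℕ) (z : closedPolydisc k) :
    ‖a n * monomial n z‖ ≤ ‖a n‖ := by
  rw [norm_mul]
  exact mul_le_of_le_one_right (norm_nonneg _) (norm_monomial_le n z)

theorem monomial_add {k : ℕ} (n m : Fin k → ℕ) (z : closedPolydisc k) :
    monomial (n + m) z = monomial n z * monomial m z := by
  simp [monomial, pow_add, Finset.prod_mul_distrib]

theorem continuous_monomial {k : ℕ} (n : Fin k → ℕ) :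
    Continuous (monomial n : closedPolydisc k → ℂ) := by
  refine continuous_finsetProd _ fun i _ => ?_
  exact ((continuous_apply i).comp continuous_subtype_val).pow _

theorem Represents.add {k : ℕ} {a b : (Fin k → ℕ) → ℂ} {f g : closedPolydisc k → ℂ}
    (hf : Represents a f) (hg : Represents b g) : Represents (a + b) (f + g) := by
  refine ⟨Summable.of_nonneg_of_le (fun n => norm_nonneg _) (fun n => norm_add_le _ _)
    (hf.1.add hg.1), fun z => ?_⟩
  simpa [add_mul] using (hf.2 z).add (hg.2 z)

theorem represents_const {k : ℕ} (c : ℂ) :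
    Represents (fun n : Fin k → ℕ => if n = 0 then c else 0) (fun _ => c) := by
  constructor
  · refine summable_of_ne_finset_zero (s := {0}) fun n hn => ?_
    simp [Finset.notMem_singleton.1 hn]
  · intro z
    have h := hasSum_single (f := fun n : Fin k → ℕ =>
      (if n = 0 then c else 0) * monomial n z) 0 (fun n hn => by simp [hn])
    simpa [monomial] using h

theorem summable_norm_fiber {P Q : Type} (g : Q → P) (u : Q → ℂ)
    (hu : Summable (fun q => ‖u q‖)) : Summable (fun p => ‖∑' q : g ⁻¹' {p}, u q‖) :=
  Summable.of_nonneg_of_le (fun _ => norm_nonneg _)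
    (fun p => norm_tsum_le_tsum_norm (f := fun q : g ⁻¹' {p} => u q)
      (hu.comp_injective Subtype.val_injective)) (hu.hasSum.tsum_fiberwise g).summable

theorem Represents.mul {k : ℕ} {a b : (Fin k → ℕ) → ℂ} {f g : closedPolydisc k → ℂ}
    (hf : Represents a f) (hg : Represents b g) :
    Represents (fun p => ∑' q : (fun q : (Fin k → ℕ) × (Fin k → ℕ) => q.1 + q.2) ⁻¹' {p},
      a q.1.1 * b q.1.2) (f * g) := by
  have hs : Summable (fun q : (Fin k → ℕ) × (Fin k → ℕ) => ‖a q.1 * b q.2‖) :=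
    Summable.mul_norm hf.1 hg.1
  refine ⟨summable_norm_fiber _ (fun q : (Fin k → ℕ) × (Fin k → ℕ) => a q.1 * b q.2) hs,
    fun z => ?_⟩
  have hsum : Summable (fun q : (Fin k → ℕ) × (Fin k → ℕ) =>
      (a q.1 * monomial q.1 z) * (b q.2 * monomial q.2 z)) := by
    refine Summable.of_norm (Summable.mul_norm (f := fun n => a n * monomial n z)
      (g := fun n => b n * monomial n z) ?_ ?_)
    · exact Summable.of_nonneg_of_le (fun _ => norm_nonneg _)
        (fun n => norm_term_le a n z) hf.1
    · exact Summable.of_nonneg_of_le (fun _ => norm_nonneg _)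
        (fun n => norm_term_le b n z) hg.1
  have h2 := ((hf.2 z).mul (hg.2 z) hsum).tsum_fiberwise
    (fun q : (Fin k → ℕ) × (Fin k → ℕ) => q.1 + q.2)
  have h3 : (fun p => (∑' q : (fun q : (Fin k → ℕ) × (Fin k → ℕ) => q.1 + q.2) ⁻¹' {p},
      a q.1.1 * b q.1.2) * monomial p z) = fun p =>
      ∑' q : (fun q : (Fin k → ℕ) × (Fin k → ℕ) => q.1 + q.2) ⁻¹' {p},
        (a q.1.1 * monomial q.1.1 z) * (b q.1.2 * monomial q.1.2 z) := by
    funext p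
    rw [← tsum_mul_right]
    refine tsum_congr fun q => ?_
    have hq : q.1.1 + q.1.2 = p := q.2
    have hm : monomial p z = monomial q.1.1 z * monomial q.1.2 z := by
      rw [← monomial_add, hq]
    rw [hm]
    ring
  rw [h3]
  exact h2

/-- The coefficients of an absolutely convergent power series are determined by its values on the
closed polydisc. -/
theorem Represents.unique {k : ℕ} {a b : (Fin k → ℕ) → ℂ} {f : closedPolydisc k → ℂ}
    (ha : Represents a f) (hb : Represents b f) : a = b := by
  let ι : (Fin k → ℕ) → (Fin k → ℤ) := fun n i => n i
  have hι : Function.Injective ι := fun n m h => by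
    funext i
    exact Int.ofNat_injective (congrFun h i)
  let E : (Fin k → ℕ) → C(UnitAddTorus (Fin k), ℂ) := fun n => UnitAddTorus.mFourier (ι n)
  have hc : Summable (fun n => ‖a n - b n‖) :=
    Summable.of_nonneg_of_le (fun n => norm_nonneg _) (fun n => norm_sub_le _ _) (ha.1.add hb.1)
  have hS : Summable (fun n => (a n - b n) • E n) := by
    refine Summable.of_norm ?_
    simpa [norm_smul, E, UnitAddTorus.mFourier_norm] using hc
  have h0 : HasSum (fun n => (a n - b n) • E n) 0 := by
    convert hS.hasSum
    ext x
    have ht := ContinuousMap.tsum_apply hS x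
    rw [← ht]
    let z : closedPolydisc k := ⟨fun i => (AddCircle.toCircle (x i) : ℂ),
      fun i => (Circle.norm_coe _).le⟩
    have h := (ha.2 z).sub (hb.2 z)
    rw [sub_self] at h
    refine h.tsum_eq.symm.trans (tsum_congr fun n => ?_)
    simp [E, ι, z, monomial, UnitAddTorus.mFourier, fourier_apply, sub_mul,
      AddCircle.toCircle_nsmul]
  funext m
  let _ : MeasureTheory.MeasureSpace UnitAddCircle := ⟨AddCircle.haarAddCircle⟩
  have : MeasureTheory.IsProbabilityMeasure
      (MeasureTheory.volume : MeasureTheory.Measure UnitAddCircle) :=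
    inferInstanceAs (MeasureTheory.IsProbabilityMeasure AddCircle.haarAddCircle)
  let L : C(UnitAddTorus (Fin k), ℂ) →L[ℂ] ℂ :=
    (innerSL ℂ (UnitAddTorus.mFourierLp 2 (ι m))).comp 
      (ContinuousMap.toLp (E := ℂ) 2 MeasureTheory.volume ℂ)
  have hL : ∀ n, L (E n) = if m = n then 1 else 0 := fun n => by
    have ho := orthonormal_iff_ite.1 (UnitAddTorus.orthonormal_mFourier (d := Fin k)) (ι m) (ι n)
    simp only [hι.eq_iff] at ho
    exact ho
  have h2 := ContinuousLinearMap.hasSum L h0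
  simp only [map_smul, hL, map_zero] at h2
  have h3 := hasSum_single m (f := fun n => (a n - b n) • (if m = n then (1 : ℂ) else 0))
    (fun n hn => by simp [Ne.symm hn])
  have h4 := h3.unique h2
  simpa [sub_eq_zero] using h4

/-- The functions of the Wiener algebra are continuous on the closed polydisc. -/
theorem Represents.continuous {k : ℕ} {a : (Fin k → ℕ) → ℂ} {f : closedPolydisc k → ℂ}
    (ha : Represents a f) : Continuous f := by
  have : f = fun z => ∑' n, a n * monomial n z := funext fun z => (ha.2 z).tsum_eq.symm
  rw [this]
  exact continuous_tsum (fun n => continuous_const.mul (continuous_monomial n)) ha.1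
    (fun n z => norm_term_le a n z)

theorem denseRange_incl (k : ℕ) : DenseRange (incl : polydisc k → closedPolydisc k) := by
  intro z
  have hmem : ∀ j : ℕ, (fun i => ((1 - 1 / ((j : ℝ) + 1) : ℝ) : ℂ) * z.1 i) ∈ polydisc k := by
    intro j i
    have h1 : 0 < 1 / ((j : ℝ) + 1) := by positivity
    have h2 : 1 / ((j : ℝ) + 1) ≤ 1 := by
      rw [div_le_one (by positivity)]
      linarith [(Nat.cast_nonneg j : (0 : ℝ) ≤ j)]
    have h3 := z.2 i
    rw [norm_mul, Complex.norm_real, Real.norm_of_nonneg (by linarith)]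
    nlinarith [norm_nonneg (z.1 i)]
  refine mem_closure_of_tendsto (f := fun j : ℕ => incl ⟨_, hmem j⟩) (b := Filter.atTop) ?_
    (Filter.Eventually.of_forall fun j => Set.mem_range_self _)
  rw [tendsto_subtype_rng, tendsto_pi_nhds]
  intro i
  have h := (tendsto_one_div_add_atTop_nhds_zero_nat (𝕜 := ℝ)).const_sub 1
  have h' := ((Complex.continuous_ofReal.tendsto _).comp h).mul_const (z.1 i)
  simpa [incl, Function.comp_def] using h'

end WienerPlus

open WienerPlus in
/-- The Wiener algebra `A⁺(𝕋^k)`: the algebra, under pointwise operations, of the functions on the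
closed polydisc that are sums of an absolutely convergent power series. -/
def WienerPlus (k : ℕ) : Subalgebra ℂ (closedPolydisc k → ℂ) where
  carrier := {f | ∃ a, Represents a f}
  mul_mem' := fun ⟨_, ha⟩ ⟨_, hb⟩ => ⟨_, ha.mul hb⟩
  add_mem' := fun ⟨_, ha⟩ ⟨_, hb⟩ => ⟨_, ha.add hb⟩
  algebraMap_mem' := fun c => ⟨_, represents_const c⟩

namespace WienerPlus

/-- The power series coefficients of `f ∈ A⁺(𝕋^k)`. -/
noncomputable def coeff {k : ℕ} (f : WienerPlus k) : (Fin k → ℕ) → ℂ := f.2.choose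

theorem represents_coeff {k : ℕ} (f : WienerPlus k) : Represents (coeff f) f.1 :=
  f.2.choose_spec

theorem coeff_eq {k : ℕ} {f : WienerPlus k} {a : (Fin k → ℕ) → ℂ} (ha : Represents a f.1) :
    coeff f = a :=
  (represents_coeff f).unique ha

/-- The norm of `A⁺(𝕋^k)`: the sum of the absolute values of the coefficients. -/
noncomputable def wienerNorm {k : ℕ} (f : WienerPlus k) : ℝ := ∑' n, ‖coeff f n‖

/-- An element of `A⁺(𝕋^k)` is determined by its values on the open polydisc. -/
theorem ext_polydisc {k : ℕ} {f g : WienerPlus k}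
    (h : ∀ z : polydisc k, f.1 (incl z) = g.1 (incl z)) : f = g :=
  Subtype.ext ((denseRange_incl k).equalizer (represents_coeff f).continuous
    (represents_coeff g).continuous (funext h))

/-- Composition with `φ : 𝔻^k → closed 𝔻^k` maps `A⁺(𝕋^k)` into itself: for every `f` in the algebra,
the function `f ∘ φ` on the open polydisc is (the restriction of) an element of the algebra. -/
def MapsIntoSelf {k : ℕ} (φ : polydisc k → closedPolydisc k) : Prop :=
  ∀ f : WienerPlus k, ∃ g : WienerPlus k, ∀ z, g.1 (incl z) = f.1 (φ z)

/-- The composition operator `C_φ f = f ∘ φ` on `A⁺(𝕋^k)`. -/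
noncomputable def compOp {k : ℕ} (φ : polydisc k → closedPolydisc k) (hφ : MapsIntoSelf φ) :
    WienerPlus k →ₐ[ℂ] WienerPlus k where
  toFun f := (hφ f).choose
  map_one' := ext_polydisc fun z => (hφ 1).choose_spec z
  map_mul' f g := ext_polydisc fun z => by
    have h1 := (hφ (f * g)).choose_spec z
    have h2 := (hφ f).choose_spec z
    have h3 := (hφ g).choose_spec z
    simp_all
  map_zero' := ext_polydisc fun z => (hφ 0).choose_spec z
  map_add' f g := ext_polydisc fun z => by
    have h1 := (hφ (f + g)).choose_spec z
    have h2 := (hφ f).choose_spec z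
    have h3 := (hφ g).choose_spec z
    simp_all
  commutes' c := ext_polydisc fun z => (hφ (algebraMap ℂ _ c)).choose_spec z

theorem compOp_apply {k : ℕ} (φ : polydisc k → closedPolydisc k) (hφ : MapsIntoSelf φ)
    (f : WienerPlus k) (z : polydisc k) : (compOp φ hφ f).1 (incl z) = f.1 (φ z) :=
  (hφ f).choose_spec z

/-- Boundedness of an operator on `A⁺(𝕋^k)` for the Wiener norm. -/
def IsBoundedOp {k : ℕ} (T : WienerPlus k →ₐ[ℂ] WienerPlus k) : Prop :=
  ∃ C : ℝ, ∀ f, wienerNorm (T f) ≤ C * wienerNorm f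

/-- `T` is an automorphism of the algebra `A⁺(𝕋^k)`. -/
def IsAutomorphism {k : ℕ} (T : WienerPlus k →ₐ[ℂ] WienerPlus k) : Prop :=
  ∃ e : WienerPlus k ≃ₐ[ℂ] WienerPlus k, (e : WienerPlus k →ₐ[ℂ] WienerPlus k) = T

end WienerPlus

/-!
Suppose that `C_φ` is an automorphism. For `‖c‖ < 1` the function `1 - c z_j` is invertible in the
algebra, so characters send `z_j` into the closed disc and Möbius transforms of the functions
`f_j = C_φ z_j` stay in the algebra. Recentring at `φ(0)` gives a map fixing the origin with a
holomorphic left inverse. By the Schwarz lemma, the Jacobian matrices of these maps have rows of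
`ℓ¹` norm at most `1`, which forces a coefficient of modulus `1` in every component, and
`∑ ‖a(n)‖² ≤ 1` leaves no room for other terms. Hence `f_j` is a Möbius transform of some
`ε_j z_{σ(j)}`.

Boundedness makes the Wiener norms of the powers `f_j ^ n` bounded. If `g` is unimodular on the
torus and its coefficients `c_i` satisfy `∑ ‖c_i‖ ≤ C`, then `1 = ∑ c_i ∫ χ_i ḡ` and
`‖∫ χ_i ḡ‖⁴ ≤ ∫ ‖g ∗ g‖²` give `C⁻⁴ ≤ ∫ ‖g ∗ g‖²`. For `g = f ^ n`, however, `(g ∗ g)(p)` is the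
`n`-th moment of the law of `f(x) f(x⁻¹p)`. When `f = f_j` and the Möbius parameter is not `0`,
almost every such law is atomless, so by Wiener's lemma these moments tend to `0` on average. This
contradiction shows that `f_j = ε_j z_{σ(j)}`.
-/

open Complex Filter Finset MeasureTheory Topology
open scoped ComplexConjugate

section Averages

theorem norm_average_le_one {E : Type*} [SeminormedAddCommGroup E] [NormedSpace ℝ E] {u : ℕ → E}
    (hu : ∀ n, ‖u n‖ ≤ 1) (N : ℕ) : ‖(N : ℝ)⁻¹ • ∑ n ∈ range N, u n‖ ≤ 1 := by
  have hsum : ‖∑ n ∈ range N, u n‖ ≤ N := by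
    simpa using norm_sum_le_of_le (range N) fun n _ => hu n
  calc ‖(N : ℝ)⁻¹ • ∑ n ∈ range N, u n‖ = (N : ℝ)⁻¹ * ‖∑ n ∈ range N, u n‖ := by
        rw [norm_smul, norm_inv, Real.norm_natCast]
    _ ≤ (N : ℝ)⁻¹ * N := by gcongr
    _ ≤ 1 := inv_mul_le_one

theorem tendsto_average_pow {v : ℂ} (hv : ‖v‖ = 1) (hv1 : v ≠ 1) :
    Tendsto (fun N : ℕ => (N : ℝ)⁻¹ • ∑ n ∈ range N, v ^ n) atTop (𝓝 0) := by
  have hlim : Tendsto (fun N : ℕ => (N : ℝ)⁻¹ * (2 / ‖v - 1‖)) atTop (𝓝 0) := by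
    simpa using tendsto_inv_atTop_nhds_zero_nat.mul_const (2 / ‖v - 1‖)
  refine squeeze_zero_norm (fun N => ?_) hlim
  rw [geom_sum_eq hv1, norm_smul, norm_div, norm_inv, Real.norm_natCast]
  gcongr
  calc ‖v ^ N - 1‖ ≤ ‖v ^ N‖ + ‖(1 : ℂ)‖ := norm_sub_le _ _
    _ = 2 := by rw [norm_pow, hv, one_pow, norm_one]; norm_num

variable {X : Type*} [MeasurableSpace X] {μ : Measure X} [IsProbabilityMeasure μ]

theorem tendsto_average_integral_pow {u : X → ℂ} (hu : Measurable u) (hu1 : ∀ x, ‖u x‖ = 1)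
    (hne : ∀ᵐ x ∂μ, u x ≠ 1) :
    Tendsto (fun N : ℕ => (N : ℝ)⁻¹ • ∑ n ∈ range N, ∫ x, u x ^ n ∂μ) atTop (𝓝 0) := by
  have hintegrable (n : ℕ) : Integrable (fun x => u x ^ n) μ :=
    .of_bound (hu.pow_const n).aestronglyMeasurable 1 (.of_forall fun x => by simp [hu1])
  have hlim : Tendsto (fun N : ℕ => ∫ x, (N : ℝ)⁻¹ • ∑ n ∈ range N, u x ^ n ∂μ) atTop
      (𝓝 (∫ _, 0 ∂μ)) := by
    refine tendsto_integral_of_dominated_convergence (fun _ => 1) (fun N => ?_)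
      (integrable_const _) (fun N => .of_forall fun x => norm_average_le_one (by simp [hu1]) N) ?_
    · exact ((integrable_finsetSum _ fun n _ => hintegrable n).smul (N : ℝ)⁻¹).aestronglyMeasurable
    · filter_upwards [hne] with x hx using tendsto_average_pow (hu1 x) hx
  simpa only [integral_smul, integral_finsetSum _ fun n _ => hintegrable n, integral_zero]
    using hlim

/-- Wiener's lemma: the squared norms of the moments of `u` are the moments of `u x * conj (u y)`,
which is almost never equal to `1` because the law of `u` has no atom. -/
theorem tendsto_average_sq_norm_integral_pow {u : X → ℂ} (hu : Measurable u)
    (hu1 : ∀ x, ‖u x‖ = 1) (hlevel : ∀ x, μ {y | u y = u x} = 0) :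
    Tendsto (fun N : ℕ => (N : ℝ)⁻¹ • ∑ n ∈ range N, ‖∫ x, u x ^ n ∂μ‖ ^ 2) atTop (𝓝 0) := by
  let w : X × X → ℂ := fun q => u q.1 * conj (u q.2)
  have hw : Measurable w := by fun_prop
  have hmoment (n : ℕ) : ∫ q, w q ^ n ∂(μ.prod μ) = ((‖∫ x, u x ^ n ∂μ‖ ^ 2 : ℝ) : ℂ) := by
    simp_rw [w, mul_pow, ← map_pow]
    rw [integral_prod_mul (fun x => u x ^ n) (fun x => conj (u x ^ n)), integral_conj, mul_conj,
      normSq_eq_norm_sq]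
  have hne : ∀ᵐ q ∂(μ.prod μ), w q ≠ 1 := by
    refine (Measure.ae_prod_iff_ae_ae (hw (measurableSet_singleton 1)).compl).2
      (.of_forall fun x => ?_)
    filter_upwards [measure_eq_zero_iff_ae_notMem.1 (hlevel x)] with y hy hxy
    have huy : conj (u y) * u y = 1 := by rw [conj_mul', hu1, ofReal_one, one_pow]
    exact hy (mul_left_cancel₀ (left_ne_zero_of_mul_eq_one huy)
      (huy.trans (by rw [← hxy, mul_comm])))
  have hlim := tendsto_average_integral_pow hw (fun q => by simp [w, hu1]) hne
  simp only [hmoment, ← ofReal_sum, real_smul, ← ofReal_mul] at hlim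
  exact (continuous_re.tendsto 0).comp hlim

end Averages

section CompactGroup

variable {G : Type*} [Group G] [TopologicalSpace G]

theorem continuous_of_hasSum_character {ι : Type*} {χ : ι → G →ₜ* Circle} {c : ι → ℂ} {f : G → ℂ}
    (hc : Summable fun i => ‖c i‖) (hf : ∀ x, HasSum (fun i => c i * χ i x) (f x)) :
    Continuous f := by
  rw [funext fun x => (hf x).tsum_eq.symm]
  exact continuous_tsum (fun i => by fun_prop) hc fun i x => by simp [Circle.norm_coe]

theorem integral_character_eq_zero [IsTopologicalGroup G] [MeasurableSpace G] [BorelSpace G]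
    {μ : Measure G} [μ.IsMulLeftInvariant] {χ : G →ₜ* Circle}
    (hχ : χ ≠ 1) : ∫ x, (χ x : ℂ) ∂μ = 0 := by
  obtain ⟨g, hg⟩ : ∃ g, χ g ≠ 1 := by
    by_contra! h
    exact hχ (ContinuousMonoidHom.ext h)
  have hinv : (χ g : ℂ) * ∫ x, (χ x : ℂ) ∂μ = ∫ x, (χ x : ℂ) ∂μ := by
    rw [← integral_const_mul, ← integral_mul_left_eq_self (fun x => (χ x : ℂ)) g]
    simp
  by_contra h
  exact hg (Circle.ext ((mul_eq_right₀ h).1 hinv))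

variable [CompactSpace G] [MeasurableSpace G] [BorelSpace G] {μ : Measure G}

theorem hasSum_integral_mul [IsProbabilityMeasure μ] {ι : Type*} [Countable ι]
    {χ : ι → G →ₜ* Circle} {c : ι → ℂ} {f : G → ℂ} (hc : Summable fun i => ‖c i‖)
    (hf : ∀ x, HasSum (fun i => c i * χ i x) (f x)) {g : G → ℂ} (hg : Continuous g) :
    HasSum (fun i => c i * ∫ x, χ i x * g x ∂μ) (∫ x, f x * g x ∂μ) := by
  have hsum := hasSum_integral_of_summable_integral_norm (μ := μ)
    (F := fun i x => c i * χ i x * g x) (fun i => ?_) ?_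
  · simp_rw [((hf _).mul_right _).tsum_eq, mul_assoc, integral_const_mul] at hsum
    exact hsum
  · exact Continuous.integrable_of_hasCompactSupport (by fun_prop) (.of_compactSpace _)
  · simpa only [norm_mul, Circle.norm_coe, mul_one, integral_const_mul] using hc.mul_right _

variable [IsTopologicalGroup G]

variable (G) in
theorem exists_isHaarMeasure_isProbabilityMeasure :
    ∃ μ : Measure G, μ.IsHaarMeasure ∧ IsProbabilityMeasure μ :=
  ⟨Measure.haarMeasure ⊤, inferInstance, ⟨Measure.haarMeasure_self⟩⟩

theorem measure_character_fiber_eq_zero [μ.IsHaarMeasure] {χ : G →ₜ* Circle}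
    (hχ : Function.Surjective χ) (z : Circle) : μ {x | χ x = z} = 0 := by
  borelize Circle
  have : Nontrivial Circle := ⟨1, -1, fun h => by
    have h' : (1 : ℂ) = -1 := congrArg ((↑) : Circle → ℂ) h
    norm_num at h'⟩
  have := Measure.isHaarMeasure_map_of_isFiniteMeasure μ χ.toMonoidHom χ.continuous hχ
  have h : μ.map χ {z} = 0 := measure_singleton z
  rwa [Measure.map_apply (map_continuous χ).measurable (measurableSet_singleton z)] at h

variable [IsProbabilityMeasure μ]

section CharacterSum

variable {ι : Type*} [Countable ι] {χ : ι → G →ₜ* Circle} {c : ι → ℂ} {f : G → ℂ}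

variable [μ.IsMulLeftInvariant]

theorem integral_mul_conj_character (hχ : Function.Injective χ) (hc : Summable fun i => ‖c i‖)
    (hf : ∀ x, HasSum (fun i => c i * χ i x) (f x)) (i : ι) :
    ∫ x, f x * conj (χ i x : ℂ) ∂μ = c i := by
  have horth (j : ι) (hj : j ≠ i) : ∫ x, (χ j x : ℂ) * conj (χ i x : ℂ) ∂μ = 0 := by
    simp_rw [← Circle.coe_inv_eq_conj, ← Circle.coe_mul]
    exact integral_character_eq_zero (χ := χ j * (χ i)⁻¹) (mul_inv_eq_one.not.2 (hχ.ne hj))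
  refine (hasSum_integral_mul hc hf (by fun_prop)).unique ?_
  convert hasSum_single i fun j hj => ?_
  · simp [mul_conj, Circle.normSq_coe]
  · rw [horth j hj, mul_zero]

theorem hasSum_sq_norm_integral_sq_norm (hχ : Function.Injective χ)
    (hc : Summable fun i => ‖c i‖) (hf : ∀ x, HasSum (fun i => c i * χ i x) (f x)) :
    HasSum (fun i => ‖c i‖ ^ 2) (∫ x, ‖f x‖ ^ 2 ∂μ) := by
  have hcont := continuous_of_hasSum_character hc hf
  have hsum := hasSum_integral_mul (μ := μ) hc hf (g := fun x => conj (f x)) (by fun_prop)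
  have hcoeff (i : ι) : ∫ x, χ i x * conj (f x) ∂μ = conj (c i) := by
    rw [← integral_mul_conj_character (μ := μ) hχ hc hf i, ← integral_conj]
    congr with x
    rw [map_mul, conj_conj, mul_comm]
  simp_rw [hcoeff, mul_conj, normSq_eq_norm_sq, integral_complex_ofReal] at hsum
  exact hasSum_ofReal.1 hsum

theorem sum_sq_norm_coeff_le_one (hχ : Function.Injective χ) (hc : Summable fun i => ‖c i‖)
    (hf : ∀ x, HasSum (fun i => c i * χ i x) (f x)) (hf1 : ∀ x, ‖f x‖ ≤ 1) (s : Finset ι) :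
    ∑ i ∈ s, ‖c i‖ ^ 2 ≤ 1 := by
  obtain ⟨μ, _, _⟩ := exists_isHaarMeasure_isProbabilityMeasure G
  refine (sum_le_hasSum s (fun i _ => sq_nonneg _)
    (hasSum_sq_norm_integral_sq_norm (μ := μ) hχ hc hf)).trans ?_
  have := norm_integral_le_of_norm_le_const (μ := μ) (f := fun x => ‖f x‖ ^ 2) (C := 1)
    (.of_forall fun x => by simpa using hf1 x)
  simpa using (le_abs_self _).trans this

end CharacterSum

end CompactGroup

section SelfConvolution

theorem sq_integral_le_integral_sq {X : Type*} [MeasurableSpace X] {μ : Measure X}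
    [IsProbabilityMeasure μ] {f : X → ℝ} (hf : Integrable f μ)
    (hf2 : Integrable (fun x => f x ^ 2) μ) : (∫ x, f x ∂μ) ^ 2 ≤ ∫ x, f x ^ 2 ∂μ :=
  even_two.convexOn_pow.map_integral_le (continuous_pow 2).continuousOn isClosed_univ
    (.of_forall fun _ => Set.mem_univ _) hf hf2

variable {G : Type*} [Group G] [MeasurableSpace G] {μ : Measure G}

/-- The convolution square `h ∗ h` of a function on a group with measure `μ`; its `L²` norm bounds
the coefficients of `h`. -/
noncomputable def selfConv (μ : Measure G) (h : G → ℂ) (p : G) : ℂ := ∫ x, h x * h (x⁻¹ * p) ∂μ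

theorem norm_selfConv_character_mul [TopologicalSpace G] (χ : G →ₜ* Circle) (h : G → ℂ)
    (p : G) : ‖selfConv μ (fun x => χ x * h x) p‖ = ‖selfConv μ h p‖ := by
  have hmul (x : G) : (χ x : ℂ) * h x * (χ (x⁻¹ * p) * h (x⁻¹ * p)) =
      χ p * (h x * h (x⁻¹ * p)) := by
    rw [mul_mul_mul_comm, ← Circle.coe_mul, ← map_mul, mul_inv_cancel_left]
  simp_rw [selfConv, hmul, integral_const_mul, norm_mul, Circle.norm_coe, one_mul]

theorem norm_selfConv_conj (h : G → ℂ) (p : G) :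
    ‖selfConv μ (fun x => conj (h x)) p‖ = ‖selfConv μ h p‖ := by
  simp_rw [selfConv, ← map_mul, integral_conj, RCLike.norm_conj]

theorem norm_selfConv_le_one [IsProbabilityMeasure μ] {h : G → ℂ} (hh : ∀ x, ‖h x‖ = 1) (p : G) :
    ‖selfConv μ h p‖ ≤ 1 := by
  simpa [selfConv] using norm_integral_le_of_norm_le_const (μ := μ) (C := 1)
    (.of_forall fun x => by simp [hh] : ∀ᵐ x ∂μ, ‖h x * h (x⁻¹ * p)‖ ≤ 1)

variable [TopologicalSpace G] [IsTopologicalGroup G] [CompactSpace G] [BorelSpace G]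
  [IsProbabilityMeasure μ] {f : G → ℂ}

theorem integral_selfConv [μ.IsMulLeftInvariant] {h : G → ℂ} (hh : Continuous h) :
    ∫ p, selfConv μ h p ∂μ = (∫ x, h x ∂μ) ^ 2 := by
  unfold selfConv
  rw [integral_integral_swap_of_hasCompactSupport (by fun_prop) (.of_compactSpace _)]
  simp_rw [integral_const_mul, integral_mul_left_eq_self h, integral_mul_const, sq]

variable [FirstCountableTopology G]

theorem continuous_selfConv {h : G → ℂ} (hh : Continuous h) : Continuous (selfConv μ h) := by
  simpa [selfConv, Function.comp_def] using!
    continuous_parametric_integral_of_continuous (μ := μ) (s := Set.univ)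
      (f := fun p x => h x * h (x⁻¹ * p)) (by fun_prop) isCompact_univ

theorem norm_integral_pow_four_le [μ.IsMulLeftInvariant] {h : G → ℂ} (hh : Continuous h) :
    ‖∫ x, h x ∂μ‖ ^ 4 ≤ ∫ p, ‖selfConv μ h p‖ ^ 2 ∂μ :=
  calc ‖∫ x, h x ∂μ‖ ^ 4 = ‖∫ p, selfConv μ h p ∂μ‖ ^ 2 := by
        rw [integral_selfConv hh, norm_pow, ← pow_mul]
    _ ≤ (∫ p, ‖selfConv μ h p‖ ∂μ) ^ 2 := by gcongr; exact norm_integral_le_integral_norm _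
    _ ≤ ∫ p, ‖selfConv μ h p‖ ^ 2 ∂μ := by
        have hcont := (continuous_selfConv (μ := μ) hh).norm
        exact sq_integral_le_integral_sq
          (hcont.integrable_of_hasCompactSupport (.of_compactSpace _))
          ((hcont.pow 2).integrable_of_hasCompactSupport (.of_compactSpace _))

theorem norm_integral_character_mul_conj_le [μ.IsMulLeftInvariant] (hf : Continuous f)
    (χ : G →ₜ* Circle) :
    ‖∫ x, χ x * conj (f x) ∂μ‖ ≤ √√(∫ p, ‖selfConv μ f p‖ ^ 2 ∂μ) := by
  have h := norm_integral_pow_four_le (μ := μ) (h := fun x => χ x * conj (f x)) (by fun_prop)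
  simp_rw [norm_selfConv_character_mul, norm_selfConv_conj] at h
  refine Real.le_sqrt_of_sq_le (Real.le_sqrt_of_sq_le ?_)
  rwa [← pow_mul]

theorem one_le_tsum_norm_pow_four_mul {ι : Type*} [Countable ι] [μ.IsMulLeftInvariant]
    {χ : ι → G →ₜ* Circle} {c : ι → ℂ} (hc : Summable fun i => ‖c i‖)
    (hf : ∀ x, HasSum (fun i => c i * χ i x) (f x)) (hf1 : ∀ x, ‖f x‖ = 1) :
    1 ≤ (∑' i, ‖c i‖) ^ 4 * ∫ p, ‖selfConv μ f p‖ ^ 2 ∂μ := by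
  have hcont := continuous_of_hasSum_character hc hf
  set J := ∫ p, ‖selfConv μ f p‖ ^ 2 ∂μ
  have hJ : 0 ≤ J := integral_nonneg fun p => sq_nonneg _
  have hone : HasSum (fun i => c i * ∫ x, χ i x * conj (f x) ∂μ) 1 := by
    simpa [mul_conj, normSq_eq_norm_sq, hf1] using
      hasSum_integral_mul (μ := μ) hc hf (g := fun x => conj (f x)) (by fun_prop)
  have hle : 1 ≤ (∑' i, ‖c i‖) * √√J := by
    have hterm (i : ι) : ‖c i * ∫ x, χ i x * conj (f x) ∂μ‖ ≤ ‖c i‖ * √√J := by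
      rw [norm_mul]
      gcongr
      exact norm_integral_character_mul_conj_le hcont (χ i)
    simpa [hone.tsum_eq] using tsum_of_norm_bounded (hc.hasSum.mul_right (√√J)) hterm
  calc 1 ≤ ((∑' i, ‖c i‖) * √√J) ^ 4 := one_le_pow₀ hle
    _ = (∑' i, ‖c i‖) ^ 4 * ((√√J) ^ 2) ^ 2 := by ring
    _ = (∑' i, ‖c i‖) ^ 4 * J := by rw [Real.sq_sqrt (Real.sqrt_nonneg _), Real.sq_sqrt hJ]

theorem tendsto_average_integral_sq_norm_selfConv_pow (hf : Continuous f) (hf1 : ∀ x, ‖f x‖ = 1)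
    (hlevel : ∀ᵐ p ∂μ, ∀ x, μ {y | f y * f (y⁻¹ * p) = f x * f (x⁻¹ * p)} = 0) :
    Tendsto (fun N : ℕ => (N : ℝ)⁻¹ • ∑ n ∈ range N, ∫ p, ‖selfConv μ (fun x => f x ^ n) p‖ ^ 2 ∂μ)
      atTop (𝓝 0) := by
  have hcont (n : ℕ) : Continuous fun p => ‖selfConv μ (fun x => f x ^ n) p‖ ^ 2 :=
    (continuous_selfConv (hf.pow n)).norm.pow 2
  have hlim : Tendsto (fun N : ℕ => ∫ p, (N : ℝ)⁻¹ • ∑ n ∈ range N,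
      ‖selfConv μ (fun x => f x ^ n) p‖ ^ 2 ∂μ) atTop (𝓝 (∫ _, 0 ∂μ)) := by
    refine tendsto_integral_of_dominated_convergence (fun _ => 1) (fun N => ?_)
      (integrable_const _) (fun N => .of_forall fun p => norm_average_le_one (fun n => ?_) N) ?_
    · exact ((continuous_finsetSum _ fun n _ => hcont n).const_smul (N : ℝ)⁻¹).aestronglyMeasurable
    · rw [norm_pow, norm_norm]
      exact pow_le_one₀ (norm_nonneg _) (norm_selfConv_le_one (by simp [hf1]) p)
    · filter_upwards [hlevel] with p hp
      simpa only [selfConv, ← mul_pow] using tendsto_average_sq_norm_integral_pow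
        (u := fun x => f x * f (x⁻¹ * p)) (by fun_prop) (by simp [hf1]) hp
  simpa only [integral_smul, integral_finsetSum _ fun n _ =>
    (hcont n).integrable_of_hasCompactSupport (.of_compactSpace _), integral_zero] using hlim

theorem not_bddAbove_tsum_norm_pow {ι : Type*} [Countable ι] [μ.IsMulLeftInvariant]
    {χ : ι → G →ₜ* Circle} {c : ℕ → ι → ℂ} (hc : ∀ n, Summable fun i => ‖c n i‖)
    (hf : ∀ n x, HasSum (fun i => c n i * χ i x) (f x ^ n)) (hf1 : ∀ x, ‖f x‖ = 1)
    (hlevel : ∀ᵐ p ∂μ, ∀ x, μ {y | f y * f (y⁻¹ * p) = f x * f (x⁻¹ * p)} = 0) :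
    ¬ BddAbove (Set.range fun n => ∑' i, ‖c n i‖) := by
  rintro ⟨C, hC⟩
  have hcont : Continuous f := by simpa using continuous_of_hasSum_character (hc 1) (hf 1)
  have hlim := (tendsto_average_integral_sq_norm_selfConv_pow hcont hf1 hlevel).const_smul (C ^ 4)
  rw [smul_zero] at hlim
  refine absurd (ge_of_tendsto hlim ?_) (not_le.2 one_pos)
  filter_upwards [eventually_gt_atTop 0] with N hN
  have hterm (n : ℕ) : 1 ≤ C ^ 4 * ∫ p, ‖selfConv μ (fun x => f x ^ n) p‖ ^ 2 ∂μ := by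
    refine (one_le_tsum_norm_pow_four_mul (μ := μ) (hc n) (hf n) (by simp [hf1])).trans ?_
    gcongr
    exact hC (Set.mem_range_self n)
  calc (1 : ℝ) = (N : ℝ)⁻¹ * ∑ n ∈ range N, 1 := by simp [hN.ne']
    _ ≤ (N : ℝ)⁻¹ * ∑ n ∈ range N, C ^ 4 * ∫ p, ‖selfConv μ (fun x => f x ^ n) p‖ ^ 2 ∂μ := by
        gcongr with n; exact hterm n
    _ = _ := by rw [← mul_sum, smul_eq_mul, smul_eq_mul, mul_left_comm]

end SelfConvolution

section Mobius

/-- The automorphism `w ↦ (w + a) / (1 + āw)` of the unit disc, for `‖a‖ < 1`. -/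
noncomputable def mobius (a w : ℂ) : ℂ := (w + a) / (1 + conj a * w)

variable {a : ℂ}

theorem mobius_zero_left (w : ℂ) : mobius 0 w = w := by simp [mobius]

theorem mobius_neg_self (a : ℂ) : mobius (-a) a = 0 := by simp [mobius]

theorem sq_norm_one_add_conj_mul_sub_sq_norm_add (a w : ℂ) :
    ‖1 + conj a * w‖ ^ 2 - ‖w + a‖ ^ 2 = (1 - ‖a‖ ^ 2) * (1 - ‖w‖ ^ 2) := by
  simp only [← normSq_eq_norm_sq, normSq_apply, add_re, add_im, mul_re, mul_im, conj_re, conj_im,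
    one_re, one_im]
  ring

theorem one_add_conj_mul_ne_zero (ha : ‖a‖ < 1) {w : ℂ} (hw : ‖w‖ ≤ 1) : 1 + conj a * w ≠ 0 := by
  intro h
  have hnorm : ‖conj a * w‖ = 1 := by rw [eq_neg_of_add_eq_zero_right h, norm_neg, norm_one]
  rw [norm_mul, RCLike.norm_conj] at hnorm
  exact (mul_le_of_le_one_right (norm_nonneg a) hw).not_gt (hnorm ▸ ha)

theorem norm_mobius_le_one (ha : ‖a‖ ≤ 1) {w : ℂ} (hw : ‖w‖ ≤ 1) : ‖mobius a w‖ ≤ 1 := by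
  rw [mobius, norm_div]
  refine div_le_one_of_le₀ (le_of_sq_le_sq ?_ (norm_nonneg _)) (norm_nonneg _)
  rw [← sub_nonneg, sq_norm_one_add_conj_mul_sub_sq_norm_add]
  exact mul_nonneg (sub_nonneg.2 (pow_le_one₀ (norm_nonneg _) ha))
    (sub_nonneg.2 (pow_le_one₀ (norm_nonneg _) hw))

theorem norm_mobius_lt_one (ha : ‖a‖ < 1) {w : ℂ} (hw : ‖w‖ < 1) : ‖mobius a w‖ < 1 := by
  rw [mobius, norm_div, div_lt_one (norm_pos_iff.2 (one_add_conj_mul_ne_zero ha hw.le))]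
  refine lt_of_pow_lt_pow_left₀ 2 (norm_nonneg _) ?_
  rw [← sub_pos, sq_norm_one_add_conj_mul_sub_sq_norm_add]
  exact mul_pos (sub_pos.2 (pow_lt_one₀ (norm_nonneg _) ha two_ne_zero))
    (sub_pos.2 (pow_lt_one₀ (norm_nonneg _) hw two_ne_zero))

theorem norm_mobius_eq_one (ha : ‖a‖ < 1) {w : ℂ} (hw : ‖w‖ = 1) : ‖mobius a w‖ = 1 := by
  rw [mobius, norm_div, div_eq_one_iff_eq (norm_ne_zero_iff.2 (one_add_conj_mul_ne_zero ha hw.le)),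
    ← sq_eq_sq₀ (norm_nonneg _) (norm_nonneg _), eq_comm, ← sub_eq_zero,
    sq_norm_one_add_conj_mul_sub_sq_norm_add, hw]
  ring

theorem one_sub_conj_mul_self_ne_zero (ha : ‖a‖ < 1) : 1 - conj a * a ≠ 0 := by
  simpa [sub_eq_add_neg] using one_add_conj_mul_ne_zero ha (w := -a) (by simpa using ha.le)

theorem mobius_neg_mobius (ha : ‖a‖ < 1) {w : ℂ} (hw : ‖w‖ ≤ 1) :
    mobius (-a) (mobius a w) = w := by
  have hden := one_add_conj_mul_ne_zero ha hw
  have hnum : mobius a w + -a = w * ((1 - conj a * a) / (1 + conj a * w)) := by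
    rw [mobius, ← sub_eq_add_neg, div_sub' hden]
    ring
  have hden' : 1 + -conj a * mobius a w = (1 - conj a * a) / (1 + conj a * w) := by
    rw [mobius, mul_div_assoc', one_add_div hden]
    ring
  rw [mobius, map_neg, hnum, hden',
    mul_div_cancel_right₀ _ (div_ne_zero (one_sub_conj_mul_self_ne_zero ha) hden)]

theorem differentiableAt_mobius (ha : ‖a‖ < 1) {w : ℂ} (hw : ‖w‖ ≤ 1) :
    DifferentiableAt ℂ (mobius a) w :=
  DifferentiableAt.div (by fun_prop) (by fun_prop) (one_add_conj_mul_ne_zero ha hw)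

/-- A Möbius product `mobius a w₁ * mobius a w₂` with `w₁ * w₂` prescribed is a homographic function
of `w₁ + w₂`, which degenerates only for `w₁ * w₂ = a / ā`. -/
theorem eq_or_eq_of_mobius_mul_mobius_eq (ha : ‖a‖ < 1) {v₁ v₂ w₁ w₂ : ℂ}
    (hv₁ : ‖v₁‖ ≤ 1) (hv₂ : ‖v₂‖ ≤ 1) (hw₁ : ‖w₁‖ ≤ 1) (hw₂ : ‖w₂‖ ≤ 1)
    (hprod : v₁ * v₂ = w₁ * w₂) (hne : conj a * (w₁ * w₂) ≠ a)
    (h : mobius a v₁ * mobius a v₂ = mobius a w₁ * mobius a w₂) : v₁ = w₁ ∨ v₁ = w₂ := by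
  have hden {w : ℂ} (hw : ‖w‖ ≤ 1) := one_add_conj_mul_ne_zero ha hw
  rw [mobius, mobius, mobius, mobius, div_mul_div_comm, div_mul_div_comm,
    div_eq_div_iff (mul_ne_zero (hden hv₁) (hden hv₂)) (mul_ne_zero (hden hw₁) (hden hw₂))] at h
  have hfactor : (a - conj a * (w₁ * w₂)) * (1 - conj a * a) * ((v₁ + v₂) - (w₁ + w₂)) = 0 := by
    linear_combination h - ((1 + conj a * w₁) * (1 + conj a * w₂)
      - conj a ^ 2 * ((w₁ + a) * (w₂ + a))) * hprod
  have hsum : (v₁ + v₂) - (w₁ + w₂) = 0 := (mul_eq_zero.1 hfactor).resolve_left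
    (mul_ne_zero (sub_ne_zero.2 hne.symm) (one_sub_conj_mul_self_ne_zero ha))
  have hroot : (v₁ - w₁) * (v₁ - w₂) = 0 := by linear_combination v₁ * hsum - hprod
  simpa only [mul_eq_zero, sub_eq_zero] using hroot

variable {G : Type*} [Group G] [TopologicalSpace G] [IsTopologicalGroup G] [CompactSpace G]

theorem measure_mobius_mul_mobius_level_eq_zero [MeasurableSpace G] [BorelSpace G] {μ : Measure G}
    [μ.IsHaarMeasure] (ha : ‖a‖ < 1) (ha0 : a ≠ 0) (ε : Circle) {θ : G →ₜ* Circle}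
    (hθ : Function.Surjective θ) :
    ∀ᵐ p ∂μ, ∀ x, μ {y | mobius a (ε * θ y) * mobius a (ε * θ (y⁻¹ * p)) =
      mobius a (ε * θ x) * mobius a (ε * θ (x⁻¹ * p))} = 0 := by
  have hnorm (x : G) : ‖(ε * θ x : ℂ)‖ ≤ 1 := by simp [Circle.norm_coe]
  have hinj {x y : G} (h : (ε * θ x : ℂ) = ε * θ y) : θ x = θ y :=
    Circle.ext (mul_left_cancel₀ ε.coe_ne_zero h)
  have hprod (p x : G) : (ε * θ x : ℂ) * (ε * θ (x⁻¹ * p)) = ε * (ε * θ p) := by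
    rw [mul_mul_mul_comm, ← Circle.coe_mul (θ x), ← map_mul, mul_inv_cancel_left, mul_assoc]
  have hgeneric : ∀ᵐ p ∂μ, conj a * (ε * (ε * θ p)) ≠ a := by
    by_cases hex : ∃ q, conj a * (ε * (ε * θ q)) = a
    · obtain ⟨q, hq⟩ := hex
      refine measure_mono_null (fun p hp => ?_) (measure_character_fiber_eq_zero hθ (θ q))
      exact hinj (mul_left_cancel₀ ε.coe_ne_zero (mul_left_cancel₀
        ((map_ne_zero _).2 ha0) ((not_not.1 hp).trans hq.symm)))
    · exact .of_forall fun p hp => hex ⟨p, hp⟩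
  filter_upwards [hgeneric] with p hp x
  refine measure_mono_null (t := {y | θ y = θ x} ∪ {y | θ y = θ (x⁻¹ * p)}) (fun y hy => ?_)
    (measure_union_null (measure_character_fiber_eq_zero hθ _)
      (measure_character_fiber_eq_zero hθ _))
  exact (eq_or_eq_of_mobius_mul_mobius_eq ha (hnorm _) (hnorm _) (hnorm _) (hnorm _)
    ((hprod p y).trans (hprod p x).symm) (by rwa [hprod]) hy).imp hinj hinj

theorem eq_zero_of_bddAbove_tsum_norm_mobius_pow [FirstCountableTopology G] (ha : ‖a‖ < 1)
    (ε : Circle) {θ : G →ₜ* Circle} (hθ : Function.Surjective θ) {ι : Type*} [Countable ι]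
    {χ : ι → G →ₜ* Circle} {c : ℕ → ι → ℂ} (hc : ∀ n, Summable fun i => ‖c n i‖)
    (hsum : ∀ n x, HasSum (fun i => c n i * χ i x) (mobius a (ε * θ x) ^ n))
    (hbdd : BddAbove (Set.range fun n => ∑' i, ‖c n i‖)) : a = 0 := by
  by_contra ha0
  borelize G
  obtain ⟨μ, _, _⟩ := exists_isHaarMeasure_isProbabilityMeasure G
  exact not_bddAbove_tsum_norm_pow (μ := μ) hc hsum
    (fun x => norm_mobius_eq_one ha (by simp [Circle.norm_coe]))
    (measure_mobius_mul_mobius_level_eq_zero ha ha0 ε hθ) hbdd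

end Mobius

section Schwarz

theorem exists_one_le_norm_of_mul_eq_one {R n : Type*} [SeminormedRing R] [NormOneClass R]
    [Fintype n] [DecidableEq n] {A B : Matrix n n R} (hA : ∀ i, ∑ j, ‖A i j‖ ≤ 1)
    (hAB : A * B = 1) (i : n) : ∃ j, 1 ≤ ‖B j i‖ := by
  by_contra! hlt
  have hdiag : ∑ j, A i j * B j i = 1 := by rw [← Matrix.mul_apply, hAB, Matrix.one_apply_eq]
  have hle : (1 : ℝ) ≤ ∑ j, ‖A i j‖ * ‖B j i‖ := by
    rw [← norm_one (α := R), ← hdiag]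
    exact (norm_sum_le _ _).trans (sum_le_sum fun j _ => norm_mul_le _ _)
  obtain ⟨l, -, hl⟩ := exists_ne_zero_of_sum_ne_zero (zero_lt_one.trans_le hle).ne'
  have hpos : 0 < ‖A i l‖ := (norm_nonneg _).lt_of_ne' (left_ne_zero_of_mul hl)
  exact (hle.trans_lt (sum_lt_sum (fun j _ => mul_le_of_le_one_right (norm_nonneg _) (hlt j).le)
    ⟨l, mem_univ l, mul_lt_of_lt_one_right hpos (hlt l)⟩)).not_ge (hA i)

theorem exists_perm_one_le_norm_of_mul_eq_one {R n : Type*} [SeminormedRing R] [NormOneClass R]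
    [Fintype n] [DecidableEq n] {A B : Matrix n n R} (hA : ∀ i, ∑ j, ‖A i j‖ ≤ 1)
    (hB : ∀ i, ∑ j, ‖B i j‖ ≤ 1) (hAB : A * B = 1) :
    ∃ σ : Equiv.Perm n, ∀ j, 1 ≤ ‖B j (σ j)‖ := by
  choose τ hτ using exists_one_le_norm_of_mul_eq_one hA hAB
  have hinj : Function.Injective τ := fun i i' h => by
    by_contra hne
    have hpair : ‖B (τ i) i‖ + ‖B (τ i) i'‖ ≤ 1 :=
      (sum_pair (f := fun l => ‖B (τ i) l‖) hne).symm.trans_le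
        ((sum_le_univ_sum_of_nonneg fun _ => norm_nonneg _).trans (hB (τ i)))
    have hi' : 1 ≤ ‖B (τ i) i'‖ := h ▸ hτ i'
    linarith [hτ i]
  let e := Equiv.ofBijective τ (Finite.injective_iff_bijective.1 hinj)
  exact ⟨e.symm, fun j => (hτ (e.symm j)).trans_eq (by rw [show τ _ = j from e.apply_symm_apply j])⟩

theorem sum_norm_apply_single_le_norm {𝕜 m n : Type*} [RCLike 𝕜] [Fintype m] [Fintype n]
    [DecidableEq n] (L : (n → 𝕜) →L[𝕜] (m → 𝕜)) (i : m) :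
    ∑ j, ‖L (Pi.single j 1) i‖ ≤ ‖L‖ := by
  open scoped Matrix.Norms.Operator in
  rw [← Matrix.linfty_opNorm_toMatrix, Matrix.linfty_opNorm_def]
  simpa [LinearMap.toMatrix'_apply, ← NNReal.coe_le_coe] using
    Finset.le_sup (f := fun i => ∑ j, ‖L (Pi.single j 1) i‖₊) (mem_univ i)

theorem exists_perm_one_le_norm_fderiv {n : Type*} [Fintype n] [DecidableEq n]
    {r q : (n → ℂ) → (n → ℂ)} (hr : DifferentiableOn ℂ r (Metric.ball 0 1))
    (hq : DifferentiableOn ℂ q (Metric.ball 0 1))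
    (hrmaps : Set.MapsTo r (Metric.ball 0 1) (Metric.closedBall 0 1))
    (hqmaps : Set.MapsTo q (Metric.ball 0 1) (Metric.closedBall 0 1))
    (hr0 : r 0 = 0) (hqr : ∀ᶠ z in 𝓝 0, q (r z) = z) :
    ∃ σ : Equiv.Perm n, ∀ j, 1 ≤ ‖fderiv ℂ r 0 (Pi.single (σ j) 1) j‖ := by
  have hball := Metric.ball_mem_nhds (0 : n → ℂ) one_pos
  have hq0 : q 0 = 0 := by simpa only [hr0] using hqr.self_of_nhds
  have hrow {h : (n → ℂ) → (n → ℂ)} (hd : DifferentiableOn ℂ h (Metric.ball 0 1))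
      (hmaps : Set.MapsTo h (Metric.ball 0 1) (Metric.closedBall 0 1)) (h0 : h 0 = 0) (i : n) :
      ∑ j, ‖fderiv ℂ h 0 (Pi.single j 1) i‖ ≤ 1 :=
    (sum_norm_apply_single_le_norm _ i).trans
      (norm_fderiv_le_one_of_mapsTo_ball hd (by rwa [h0]) one_pos)
  have hcomp : fderiv ℂ q 0 ∘L fderiv ℂ r 0 = ContinuousLinearMap.id ℂ _ := by
    have hq' : HasFDerivAt q (fderiv ℂ q 0) (r 0) := by
      rw [hr0]
      exact (hq.differentiableAt hball).hasFDerivAt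
    exact (hq'.comp 0 (hr.differentiableAt hball).hasFDerivAt).unique
      ((hasFDerivAt_id 0).congr_of_eventuallyEq hqr)
  refine exists_perm_one_le_norm_of_mul_eq_one
    (A := LinearMap.toMatrix' (fderiv ℂ q 0 : (n → ℂ) →ₗ[ℂ] (n → ℂ)))
    (B := LinearMap.toMatrix' (fderiv ℂ r 0 : (n → ℂ) →ₗ[ℂ] (n → ℂ)))
    (fun i => ?_) (fun i => ?_) ?_
  · simpa [LinearMap.toMatrix'_apply] using hrow hq hqmaps hq0 i
  · simpa [LinearMap.toMatrix'_apply] using hrow hr hrmaps hr0 i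
  · rw [← LinearMap.toMatrix'_comp, ← ContinuousLinearMap.toLinearMap_comp, hcomp,
      ContinuousLinearMap.coe_id, LinearMap.toMatrix'_id]

variable {E F : Type*} [NormedAddCommGroup E] [NormedSpace ℂ E] [NormedAddCommGroup F]
  [NormedSpace ℂ F]

theorem norm_fderiv_le_of_forall_ball_norm_le {f : E → F} {c : E} {R C : ℝ} (hR : 0 < R)
    (hf : DifferentiableOn ℂ f (Metric.ball c R)) (hC : ∀ x ∈ Metric.ball c R, ‖f x‖ ≤ C) :
    ‖fderiv ℂ f c‖ ≤ 2 * C / R := by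
  refine norm_fderiv_le_div_of_mapsTo_ball hf (fun x hx => ?_) hR
  rw [mem_closedBall_iff_norm, two_mul]
  exact (norm_sub_le _ _).trans (add_le_add (hC x hx) (hC c (Metric.mem_ball_self hR)))

section Series

variable {ι : Type*} {U : Set E} {f : ι → E → F} {u : ι → ℝ} {x : E}

theorem summable_norm_fderiv_of_summable_norm (hu : Summable u) (hU : U ∈ 𝓝 x)
    (hf : ∀ i, DifferentiableOn ℂ (f i) U) (hfu : ∀ i, ∀ y ∈ U, ‖f i y‖ ≤ u i) :
    Summable fun i => ‖fderiv ℂ (f i) x‖ := by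
  obtain ⟨R, hR, hRU⟩ := Metric.mem_nhds_iff.1 hU
  exact .of_nonneg_of_le (fun i => norm_nonneg _)
    (fun i => norm_fderiv_le_of_forall_ball_norm_le hR ((hf i).mono hRU)
      fun y hy => hfu i y (hRU hy)) ((hu.mul_left 2).div_const R)

theorem hasFDerivAt_tsum_of_summable_norm [CompleteSpace F] (hu : Summable u) (hU : U ∈ 𝓝 x)
    (hf : ∀ i, DifferentiableOn ℂ (f i) U) (hfu : ∀ i, ∀ y ∈ U, ‖f i y‖ ≤ u i) :
    HasFDerivAt (fun y => ∑' i, f i y) (∑' i, fderiv ℂ (f i) x) x := by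
  obtain ⟨R, hR, hRU⟩ := Metric.mem_nhds_iff.1 hU
  have hsub {y : E} (hy : y ∈ Metric.ball x (R / 2)) : Metric.ball y (R / 2) ⊆ U := by
    refine (Metric.ball_subset_ball' ?_).trans hRU
    linarith [Metric.mem_ball.1 hy]
  have hx : x ∈ Metric.ball x (R / 2) := Metric.mem_ball_self (half_pos hR)
  refine hasFDerivAt_tsum_of_isPreconnected ((hu.mul_left 2).div_const (R / 2)) Metric.isOpen_ball
    Metric.isPreconnected_ball (fun i y hy => ?_) (fun i y hy => ?_) hx
    (.of_norm_bounded hu fun i => hfu i x (mem_of_mem_nhds hU)) hx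
  · exact ((hf i).differentiableAt (mem_of_superset (Metric.ball_mem_nhds y (half_pos hR))
      (hsub hy))).hasFDerivAt
  · exact norm_fderiv_le_of_forall_ball_norm_le (half_pos hR) ((hf i).mono (hsub hy))
      fun v hv => hfu i v (hsub hy hv)

end Series

end Schwarz

theorem pow_injective_circle : Function.Injective fun (n : ℕ) (z : Circle) => z ^ n := by
  intro n m hnm
  by_contra! hne
  wlog hlt : n < m generalizing n m
  · exact this hnm.symm hne.symm (hne.lt_or_gt.resolve_left hlt)
  have hd : 0 < m - n := Nat.sub_pos_of_lt hlt
  let z := Circle.exp (Real.pi / (m - n : ℕ))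
  have hz : z ^ (m - n) = Circle.exp Real.pi := by
    rw [← Circle.exp_nsmul, nsmul_eq_mul, mul_div_cancel₀ _ (by exact_mod_cast hd.ne')]
  refine Circle.exp_pi_ne_one (hz ▸ mul_left_cancel (a := z ^ n) ?_)
  rw [← pow_add, Nat.add_sub_cancel' hlt.le, mul_one]
  exact (congrFun hnm z).symm

namespace WienerPlus

variable {k : ℕ}

section Torus

/-- The points of the torus, which is the distinguished boundary of the polydisc. -/
def torusPoint (x : Fin k → Circle) : closedPolydisc k := ⟨fun i => x i, fun i => (x i).norm_coe.le⟩

/-- The restriction of a monomial to the torus, as a character. -/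
noncomputable def monomialCharacter (n : Fin k → ℕ) : (Fin k → Circle) →ₜ* Circle where
  toFun x := ∏ i, x i ^ n i
  map_one' := by simp
  map_mul' x y := by simp [mul_pow, prod_mul_distrib]
  continuous_toFun := by fun_prop

theorem coe_monomialCharacter (n : Fin k → ℕ) (x : Fin k → Circle) :
    (monomialCharacter n x : ℂ) = monomial n (torusPoint x) :=
  (map_prod Circle.coeHom _ _).trans (prod_congr rfl fun i _ => Circle.coe_pow (x i) (n i))

theorem monomialCharacter_apply_mulSingle (n : Fin k → ℕ) (i : Fin k) (z : Circle) :
    monomialCharacter n (Pi.mulSingle i z) = z ^ n i := by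
  change ∏ j, (Pi.mulSingle i z : Fin k → Circle) j ^ n j = z ^ n i
  rw [Fintype.prod_eq_single i fun j hj => by rw [Pi.mulSingle_eq_of_ne hj, one_pow],
    Pi.mulSingle_eq_same]

theorem monomialCharacter_injective :
    Function.Injective (monomialCharacter : (Fin k → ℕ) → (Fin k → Circle) →ₜ* Circle) := by
  refine fun n m hnm => funext fun i => pow_injective_circle (funext fun z => ?_)
  simpa only [monomialCharacter_apply_mulSingle] using DFunLike.congr_fun hnm (Pi.mulSingle i z)

theorem monomialCharacter_single_surjective (i : Fin k) :
    Function.Surjective (monomialCharacter (Pi.single i 1)) := fun z =>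
  ⟨Pi.mulSingle i z, by rw [monomialCharacter_apply_mulSingle, Pi.single_eq_same, pow_one]⟩

theorem Represents.hasSum_monomialCharacter {a : (Fin k → ℕ) → ℂ} {f : closedPolydisc k → ℂ}
    (ha : Represents a f) (x : Fin k → Circle) :
    HasSum (fun n => a n * monomialCharacter n x) (f (torusPoint x)) := by
  simpa only [coe_monomialCharacter] using ha.2 (torusPoint x)

end Torus

section Coefficients

theorem monomial_single (i : Fin k) (m : ℕ) (z : closedPolydisc k) :
    monomial (Pi.single i m) z = z.1 i ^ m := by
  rw [monomial, Fintype.prod_eq_single i fun j hj => by rw [Pi.single_eq_of_ne hj, pow_zero],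
    Pi.single_eq_same]

theorem Represents.sum_sq_norm_le_one {a : (Fin k → ℕ) → ℂ} {f : closedPolydisc k → ℂ}
    (ha : Represents a f) (hf : ∀ z, ‖f z‖ ≤ 1) (s : Finset (Fin k → ℕ)) :
    ∑ n ∈ s, ‖a n‖ ^ 2 ≤ 1 := by
  borelize Circle
  exact sum_sq_norm_coeff_le_one monomialCharacter_injective ha.1 ha.hasSum_monomialCharacter
    (fun x => hf (torusPoint x)) s

theorem Represents.norm_le_one {a : (Fin k → ℕ) → ℂ} {f : closedPolydisc k → ℂ}
    (ha : Represents a f) (hf : ∀ z, ‖f z‖ ≤ 1) (n : Fin k → ℕ) : ‖a n‖ ≤ 1 := by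
  simpa using ha.sum_sq_norm_le_one hf {n}

theorem Represents.eq_monomial_of_one_le_norm {a : (Fin k → ℕ) → ℂ} {f : closedPolydisc k → ℂ}
    (ha : Represents a f) (hf : ∀ z, ‖f z‖ ≤ 1) {m : Fin k → ℕ} (hm : 1 ≤ ‖a m‖)
    (z : closedPolydisc k) : f z = a m * monomial m z := by
  refine (ha.2 z).unique (hasSum_single m fun n hn => ?_)
  have hsum := ha.sum_sq_norm_le_one hf {m, n}
  rw [sum_pair hn.symm] at hsum
  have hn0 : ‖a n‖ ^ 2 ≤ 0 := by linarith [one_le_pow₀ hm (n := 2)]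
  rw [norm_eq_zero.1 (pow_eq_zero_iff two_ne_zero |>.1 (hn0.antisymm (by positivity))), zero_mul]

theorem represents_extend {ι : Type*} {e : ι → Fin k → ℕ} (he : Function.Injective e) {b : ι → ℂ}
    (hb : Summable fun i => ‖b i‖) {f : closedPolydisc k → ℂ}
    (hf : ∀ z, HasSum (fun i => b i * monomial (e i) z) (f z)) :
    Represents (Function.extend e b 0) f := by
  constructor
  · convert (summable_extend_zero he).2 hb using 2 with n
    rw [Function.apply_extend norm]
    congr 1
    exact funext fun _ => norm_zero
  · intro z
    convert (hasSum_extend_zero he).2 (hf z) using 2 with n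
    by_cases hn : ∃ i, e i = n
    · obtain ⟨i, rfl⟩ := hn
      rw [he.extend_apply, he.extend_apply]
    · rw [Function.extend_apply' _ _ _ hn, Function.extend_apply' _ _ _ hn, Pi.zero_apply,
        zero_mul]

theorem represents_monomial (n : Fin k → ℕ) : Represents (Pi.single n 1) (monomial n) := by
  refine ⟨summable_of_ne_finset_zero (s := {n}) fun m hm => ?_, fun z => ?_⟩
  · rw [Pi.single_eq_of_ne (notMem_singleton.1 hm), norm_zero]
  · convert hasSum_pi_single n (monomial n z) using 2 with m
    rcases eq_or_ne m n with rfl | hm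
    · simp only [Pi.single_eq_same, one_mul]
    · simp only [Pi.single_eq_of_ne hm, zero_mul]

/-- The centre of the polydisc. -/
def origin (k : ℕ) : polydisc k := ⟨0, fun i => by simp⟩

theorem coeff_zero (f : WienerPlus k) : coeff f 0 = f.1 (incl (origin k)) := by
  have hsum := hasSum_single (0 : Fin k → ℕ) (fun n hn => ?_) |>.unique
    ((represents_coeff f).2 (incl (origin k)))
  · simpa [monomial] using hsum
  · obtain ⟨i, hi⟩ := Function.ne_iff.1 hn
    rw [monomial, prod_eq_zero (mem_univ i) (zero_pow hi), mul_zero]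

end Coefficients

section Coordinates

/-- The coordinate functions. -/
noncomputable def coord (i : Fin k) : WienerPlus k :=
  ⟨monomial (Pi.single i 1), _, represents_monomial _⟩

theorem coord_apply (i : Fin k) (z : closedPolydisc k) : (coord i).1 z = z.1 i :=
  (monomial_single i 1 z).trans (pow_one _)

theorem wienerNorm_coord_pow (i : Fin k) (m : ℕ) : wienerNorm (coord i ^ m) = 1 := by
  have hpow : (coord i ^ m).1 = monomial (Pi.single i m) := funext fun z =>
    (congrArg (· ^ m) (coord_apply i z)).trans (monomial_single i m z).symm
  rw [wienerNorm, coeff_eq (hpow ▸ represents_monomial _), tsum_eq_single (Pi.single i m)]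
  · rw [Pi.single_eq_same, norm_one]
  · exact fun n hn => by rw [Pi.single_eq_of_ne hn, norm_zero]

theorem isUnit_one_sub_smul_coord (i : Fin k) {c : ℂ} (hc : ‖c‖ < 1) :
    IsUnit (1 - c • coord i : WienerPlus k) := by
  have hlt (z : closedPolydisc k) : ‖c * z.1 i‖ < 1 := by
    rw [norm_mul]
    exact (mul_le_of_le_one_right (norm_nonneg c) (z.2 i)).trans_lt hc
  have hrep : Represents (Function.extend (Pi.single i) (fun m : ℕ => c ^ m) 0)
      fun z : closedPolydisc k => (1 - c * z.1 i)⁻¹ := by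
    refine represents_extend (Pi.single_injective (M := fun _ : Fin k => ℕ) i) ?_ fun z => ?_
    · simpa only [norm_pow] using summable_geometric_of_lt_one (norm_nonneg c) hc
    · simpa only [monomial_single, mul_pow] using hasSum_geometric_of_norm_lt_one (hlt z)
  refine IsUnit.of_mul_eq_one ⟨_, _, hrep⟩ (Subtype.ext (funext fun z => ?_))
  have hne : 1 - c * z.1 i ≠ 0 := sub_ne_zero.2 fun h => (hlt z).ne (h ▸ norm_one)
  change (1 - c * (coord i).1 z) * (1 - c * z.1 i)⁻¹ = 1
  rw [coord_apply, mul_inv_cancel₀ hne]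

theorem norm_character_coord_le_one (ψ : WienerPlus k →ₐ[ℂ] ℂ) (i : Fin k) : ‖ψ (coord i)‖ ≤ 1 := by
  by_contra! h
  have hne : ψ (coord i) ≠ 0 := norm_pos_iff.1 (zero_lt_one.trans h)
  have hunit := (isUnit_one_sub_smul_coord i (c := (ψ (coord i))⁻¹)
    (by rw [norm_inv]; exact inv_lt_one_of_one_lt₀ h)).map ψ
  rw [map_sub, map_one, map_smul, smul_eq_mul, inv_mul_cancel₀ hne, sub_self] at hunit
  exact not_isUnit_zero hunit

theorem exists_forall_character_eq_mobius (i : Fin k) {a : ℂ} (ha : ‖a‖ < 1) :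
    ∃ M : WienerPlus k, ∀ ψ : WienerPlus k →ₐ[ℂ] ℂ, ψ M = mobius a (ψ (coord i)) := by
  obtain ⟨v, hv⟩ :=
    (isUnit_one_sub_smul_coord i (c := -conj a) (by simpa using ha)).exists_right_inv
  refine ⟨(coord i + algebraMap ℂ _ a) * v, fun ψ => ?_⟩
  have hψv : (1 + conj a * ψ (coord i)) * ψ v = 1 := by
    simpa [sub_eq_add_neg] using congrArg ψ hv
  rw [mobius, map_mul, map_add, AlgHom.commutes, Algebra.algebraMap_self_apply, div_eq_mul_inv,
    eq_inv_of_mul_eq_one_right hψv]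

/-- Evaluation at a point of the closed polydisc. -/
def eval (z : closedPolydisc k) : WienerPlus k →ₐ[ℂ] ℂ :=
  (Pi.evalAlgHom ℂ _ z).comp (WienerPlus k).val

theorem norm_algHom_coord_le_one (S : WienerPlus k →ₐ[ℂ] WienerPlus k) (i : Fin k)
    (z : closedPolydisc k) : ‖(S (coord i)).1 z‖ ≤ 1 :=
  norm_character_coord_le_one ((eval z).comp S) i

theorem norm_algHom_coord_origin_lt_one {S : WienerPlus k →ₐ[ℂ] WienerPlus k}
    (hS : Function.Injective S) (i : Fin k) : ‖(S (coord i)).1 (incl (origin k))‖ < 1 := by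
  by_contra! h
  rw [← coeff_zero] at h
  have hconst : S (coord i) = S (algebraMap ℂ _ (coeff (S (coord i)) 0)) := by
    rw [AlgHom.commutes]
    refine Subtype.ext (funext fun z => ?_)
    rw [(represents_coeff (S (coord i))).eq_monomial_of_one_le_norm
      (norm_algHom_coord_le_one S i) h z]
    simp [monomial]
  have hcoord (x : Fin k → Circle) : (x i : ℂ) = coeff (S (coord i)) 0 :=
    (coord_apply i (torusPoint x)).symm.trans
      (congrArg (fun f : WienerPlus k => f.1 (torusPoint x)) (hS hconst))
  have hneg : (1 : ℂ) = -1 := (hcoord 1).trans (hcoord (-1)).symm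
  norm_num at hneg

end Coordinates

section Extension

/-- The sum of the power series of `f` as a function on `ℂ^k`, so that derivatives make sense; its
value is meaningless outside the closed polydisc. -/
noncomputable def extension (f : WienerPlus k) (w : Fin k → ℂ) : ℂ :=
  ∑' n, coeff f n * ∏ i, w i ^ n i

theorem extension_eq (f : WienerPlus k) (z : closedPolydisc k) : extension f z.1 = f.1 z :=
  ((represents_coeff f).2 z).tsum_eq

theorem polydisc_eq_ball : polydisc k = Metric.ball 0 1 := by
  ext w
  rw [mem_ball_zero_iff, pi_norm_lt_iff one_pos]
  rfl

theorem norm_extension_le_one {f : WienerPlus k} (hf : ∀ z, ‖f.1 z‖ ≤ 1) {w : Fin k → ℂ}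
    (hw : w ∈ Metric.ball (0 : Fin k → ℂ) 1) : ‖extension f w‖ ≤ 1 := by
  rw [← polydisc_eq_ball] at hw
  exact (extension_eq f (incl ⟨w, hw⟩)).symm ▸ hf _

theorem differentiable_const_mul_prod_pow (c : ℂ) (n : Fin k → ℕ) :
    Differentiable ℂ fun v : Fin k → ℂ => c * ∏ i, v i ^ n i := fun v =>
  DifferentiableAt.const_mul (by fun_prop) c

theorem hasFDerivAt_extension (f : WienerPlus k) {w : Fin k → ℂ}
    (hw : w ∈ Metric.ball (0 : Fin k → ℂ) 1) :
    HasFDerivAt (extension f) (∑' n, fderiv ℂ (fun v => coeff f n * ∏ i, v i ^ n i) w) w :=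
  hasFDerivAt_tsum_of_summable_norm (represents_coeff f).1 (Metric.isOpen_ball.mem_nhds hw)
    (fun n => (differentiable_const_mul_prod_pow _ n).differentiableOn) fun n v hv =>
      norm_term_le (coeff f) n (incl ⟨v, polydisc_eq_ball (k := k) ▸ hv⟩)

theorem differentiableOn_extension (f : WienerPlus k) :
    DifferentiableOn ℂ (extension f) (Metric.ball 0 1) := fun _ hw =>
  (hasFDerivAt_extension f hw).differentiableAt.differentiableWithinAt

theorem fderiv_prod_pow_zero (n : Fin k → ℕ) (i : Fin k) :
    fderiv ℂ (fun v : Fin k → ℂ => ∏ j, v j ^ n j) 0 (Pi.single i 1) =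
      if n = Pi.single i 1 then 1 else 0 := by
  have hderiv : fderiv ℂ (fun v : Fin k → ℂ => ∏ j, v j ^ n j) 0 (Pi.single i 1) =
      (∏ j ∈ univ.erase i, 0 ^ n j) * (n i * 0 ^ (n i - 1)) := by
    have hpow (j : Fin k) : fderiv ℂ (fun v : Fin k → ℂ => v j ^ n j) 0 (Pi.single i 1) =
        n j * 0 ^ (n j - 1) * (Pi.single i 1 : Fin k → ℂ) j := by
      rw [fderiv_fun_pow _ (by fun_prop), fderiv_apply (by fun_prop) j]
      simp
    rw [fderiv_finsetProd fun j _ => by fun_prop, _root_.sum_apply, sum_eq_single i]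
    · simp [hpow]
    · intro j _ hj
      simp [hpow, hj]
    · simp
  rw [hderiv]
  split_ifs with hn
  · subst hn
    rw [Pi.single_eq_same, prod_eq_one fun j hj => by
      rw [Pi.single_eq_of_ne (ne_of_mem_erase hj), pow_zero]]
    simp
  · by_contra h
    obtain ⟨hother, hi, hi'⟩ := by
      simpa only [mul_ne_zero_iff, prod_ne_zero_iff, pow_ne_zero_iff] using h
    refine hn (funext fun j => ?_)
    rcases eq_or_ne j i with rfl | hj
    · have hle : n j - 1 = 0 := of_not_not fun hne => hi' (zero_pow hne)
      have hpos : n j ≠ 0 := Nat.cast_ne_zero.1 hi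
      rw [Pi.single_eq_same]
      omega
    · rw [Pi.single_eq_of_ne hj]
      exact of_not_not fun hne => hother j (mem_erase.2 ⟨hj, mem_univ j⟩) (zero_pow hne)

theorem fderiv_extension_zero (f : WienerPlus k) (i : Fin k) :
    fderiv ℂ (extension f) 0 (Pi.single i 1) = coeff f (Pi.single i 1) := by
  have hball := Metric.ball_mem_nhds (0 : Fin k → ℂ) one_pos
  have hsum := (summable_norm_fderiv_of_summable_norm (represents_coeff f).1 hball
    (fun n => (differentiable_const_mul_prod_pow _ n).differentiableOn) fun n v hv =>
      norm_term_le (coeff f) n (incl ⟨v, polydisc_eq_ball (k := k) ▸ hv⟩)).of_norm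
  have hterm (n : Fin k → ℕ) : fderiv ℂ (fun v => coeff f n * ∏ i, v i ^ n i) 0 (Pi.single i 1) =
      if n = Pi.single i 1 then coeff f n else 0 := by
    rw [fderiv_const_mul (by fun_prop), smul_apply, fderiv_prod_pow_zero,
      smul_eq_mul, mul_ite, mul_one, mul_zero]
  rw [(hasFDerivAt_extension f (Metric.mem_ball_self one_pos)).fderiv]
  refine ((ContinuousLinearMap.apply ℂ ℂ (Pi.single i 1)).map_tsum hsum).trans ?_
  simp only [ContinuousLinearMap.apply_apply, hterm, tsum_ite_eq]

end Extension

section Cartan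

/-- The self-map `z ↦ (ε₁ z_{σ(1)}, …, ε_k z_{σ(k)})` of the closed polydisc, with its inverse. -/
noncomputable def rotPerm (σ : Equiv.Perm (Fin k)) (ε : Fin k → Circle) :
    closedPolydisc k ≃ closedPolydisc k where
  toFun z := ⟨fun j => ε j * z.1 (σ j), fun j => by simpa [Circle.norm_coe] using z.2 (σ j)⟩
  invFun z := ⟨fun j => (ε (σ⁻¹ j))⁻¹ * z.1 (σ⁻¹ j), fun j => by
    simpa [Circle.norm_coe] using z.2 (σ⁻¹ j)⟩
  left_inv z := Subtype.ext (funext fun j => by simp)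
  right_inv z := Subtype.ext (funext fun j => by simp)

theorem exists_forall_eq_mul_of_leftInverse {R : Fin k → WienerPlus k}
    {q : (Fin k → ℂ) → Fin k → ℂ} (hR : ∀ j z, ‖(R j).1 z‖ ≤ 1)
    (hR0 : ∀ j, (R j).1 (incl (origin k)) = 0) (hq : DifferentiableOn ℂ q (Metric.ball 0 1))
    (hqmaps : Set.MapsTo q (Metric.ball 0 1) (Metric.closedBall 0 1))
    (hqR : ∀ z : polydisc k, q (fun j => (R j).1 (incl z)) = z.1) :
    ∃ (σ : Equiv.Perm (Fin k)) (ε : Fin k → Circle), ∀ j z, (R j).1 z = ε j * z.1 (σ j) := by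
  let r : (Fin k → ℂ) → Fin k → ℂ := fun w j => extension (R j) w
  have hr : DifferentiableOn ℂ r (Metric.ball 0 1) :=
    differentiableOn_pi.2 fun j => differentiableOn_extension (R j)
  have hr_apply (z : polydisc k) : r z.1 = fun j => (R j).1 (incl z) :=
    funext fun j => extension_eq (R j) (incl z)
  have hrmaps : Set.MapsTo r (Metric.ball 0 1) (Metric.closedBall 0 1) := fun w hw => by
    rw [mem_closedBall_zero_iff, pi_norm_le_iff_of_nonneg zero_le_one]
    exact fun j => norm_extension_le_one (hR j) hw
  obtain ⟨σ, hσ⟩ := exists_perm_one_le_norm_fderiv hr hq hrmaps hqmaps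
    ((hr_apply (origin k)).trans (funext hR0)) <| by
      filter_upwards [Metric.ball_mem_nhds (0 : Fin k → ℂ) one_pos] with w hw
      let z : polydisc k := ⟨w, polydisc_eq_ball (k := k) ▸ hw⟩
      exact (congrArg q (hr_apply z)).trans (hqR z)
  have hcoeff (j i : Fin k) : fderiv ℂ r 0 (Pi.single i 1) j = coeff (R j) (Pi.single i 1) := by
    have hr' := hr.differentiableAt (Metric.ball_mem_nhds (0 : Fin k → ℂ) one_pos)
    rw [← fderiv_extension_zero]
    exact (DFunLike.congr_fun (fderiv_apply hr' j) _).symm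
  have hone (j : Fin k) : 1 ≤ ‖coeff (R j) (Pi.single (σ j) 1)‖ := hcoeff j (σ j) ▸ hσ j
  refine ⟨σ, fun j => ⟨coeff (R j) (Pi.single (σ j) 1), mem_sphere_zero_iff_norm.2
    (((represents_coeff (R j)).norm_le_one (hR j) _).antisymm (hone j))⟩, fun j z => ?_⟩
  rw [(represents_coeff (R j)).eq_monomial_of_one_le_norm (hR j) (hone j), monomial_single, pow_one]

end Cartan

section CompositionOperator

variable {φ : polydisc k → closedPolydisc k} {hφ : MapsIntoSelf φ}

theorem mobius_mem_ball {a w : Fin k → ℂ} (ha : ∀ j, ‖a j‖ < 1)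
    (hw : w ∈ Metric.ball (0 : Fin k → ℂ) 1) :
    (fun j => mobius (a j) (w j)) ∈ Metric.ball (0 : Fin k → ℂ) 1 := by
  rw [← polydisc_eq_ball] at hw ⊢
  exact fun j => norm_mobius_lt_one (ha j) (hw j)

theorem differentiableOn_extension_comp_mobius (f : WienerPlus k) {a : Fin k → ℂ}
    (ha : ∀ j, ‖a j‖ < 1) :
    DifferentiableOn ℂ (fun w : Fin k → ℂ => extension f fun j => mobius (a j) (w j))
      (Metric.ball 0 1) := by
  refine (differentiableOn_extension f).comp (differentiableOn_pi.2 fun j w hw => ?_)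
    fun w hw => mobius_mem_ball ha hw
  have hwj : ‖w j‖ ≤ 1 := (norm_le_pi_norm w j).trans (mem_ball_zero_iff.1 hw).le
  exact ((differentiableAt_mobius (ha j) hwj).comp (f := fun w : Fin k → ℂ => w j) w
    (by fun_prop)).differentiableWithinAt

theorem exists_algHom_coord_eq_mobius {S : WienerPlus k →ₐ[ℂ] WienerPlus k}
    (hS : Function.Injective S) :
    ∃ (a : Fin k → ℂ) (R : Fin k → WienerPlus k), (∀ j, ‖a j‖ < 1) ∧
      (∀ j z, ‖(R j).1 z‖ ≤ 1) ∧ (∀ j, (R j).1 (incl (origin k)) = 0) ∧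
      ∀ j z, (S (coord j)).1 z = mobius (a j) ((R j).1 z) := by
  let a (j : Fin k) : ℂ := (S (coord j)).1 (incl (origin k))
  have ha (j : Fin k) : ‖a j‖ < 1 := norm_algHom_coord_origin_lt_one hS j
  have ha' (j : Fin k) : ‖-a j‖ < 1 := (norm_neg (a j)).trans_lt (ha j)
  choose M hM using fun j => exists_forall_character_eq_mobius j (ha' j)
  have hR (j : Fin k) (z : closedPolydisc k) : (S (M j)).1 z = mobius (-a j) ((S (coord j)).1 z) :=
    hM j ((eval z).comp S)
  refine ⟨a, fun j => S (M j), ha, fun j z => ?_, fun j => ?_, fun j z => ?_⟩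
  · exact hR j z ▸ norm_mobius_le_one (ha' j).le (norm_algHom_coord_le_one S j z)
  · exact (hR j _).trans (mobius_neg_self (a j))
  · have hinv := mobius_neg_mobius (ha' j) (norm_algHom_coord_le_one S j z)
    rwa [neg_neg, ← hR, eq_comm] at hinv

theorem exists_compOp_coord_eq_mobius (haut : IsAutomorphism (compOp φ hφ)) :
    ∃ (a : Fin k → ℂ) (σ : Equiv.Perm (Fin k)) (ε : Fin k → Circle), (∀ j, ‖a j‖ < 1) ∧
      ∀ j z, (compOp φ hφ (coord j)).1 z = mobius (a j) (ε j * z.1 (σ j)) := by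
  obtain ⟨e, he⟩ := haut
  obtain ⟨a, R, ha, hR, hR0, hcoord⟩ := exists_algHom_coord_eq_mobius (S := compOp φ hφ)
    (he ▸ e.injective)
  let T : WienerPlus k →ₐ[ℂ] WienerPlus k := e.symm
  let q (w : Fin k → ℂ) (i : Fin k) : ℂ := extension (T (coord i)) fun j => mobius (a j) (w j)
  have hq : DifferentiableOn ℂ q (Metric.ball 0 1) :=
    differentiableOn_pi.2 fun i => differentiableOn_extension_comp_mobius _ ha
  have hqmaps : Set.MapsTo q (Metric.ball 0 1) (Metric.closedBall 0 1) := fun w hw => by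
    rw [mem_closedBall_zero_iff, pi_norm_le_iff_of_nonneg zero_le_one]
    exact fun i => norm_extension_le_one (norm_algHom_coord_le_one T i) (mobius_mem_ball ha hw)
  have hqR (z : polydisc k) : q (fun j => (R j).1 (incl z)) = z.1 := by
    funext i
    have hφz : (fun j => mobius (a j) ((R j).1 (incl z))) = (φ z).1 :=
      funext fun j => by rw [← hcoord, compOp_apply, coord_apply]
    have hT : compOp φ hφ (T (coord i)) = coord i := he ▸ e.apply_symm_apply _
    rw [show q _ i = _ from congrArg (extension _) hφz, extension_eq, ← compOp_apply φ hφ, hT,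
      coord_apply]
    rfl
  obtain ⟨σ, ε, hσε⟩ := exists_forall_eq_mul_of_leftInverse hR hR0 hq hqmaps hqR
  exact ⟨a, σ, ε, ha, fun j z => (hcoord j z).trans (by rw [hσε])⟩

theorem eq_zero_of_bddAbove_wienerNorm_pow {f : WienerPlus k} {a : ℂ} {ε : Circle} {i : Fin k}
    (ha : ‖a‖ < 1) (hf : ∀ z, f.1 z = mobius a (ε * z.1 i))
    (hbdd : BddAbove (Set.range fun n : ℕ => wienerNorm (f ^ n))) : a = 0 := by
  refine eq_zero_of_bddAbove_tsum_norm_mobius_pow (χ := monomialCharacter) ha ε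
    (monomialCharacter_single_surjective i)
    (fun n => (represents_coeff (f ^ n)).1) (fun n x => ?_) hbdd
  have hx : mobius a (ε * monomialCharacter (Pi.single i 1) x) = f.1 (torusPoint x) := by
    rw [hf, coe_monomialCharacter, monomial_single, pow_one]
  rw [hx]
  exact (represents_coeff (f ^ n)).hasSum_monomialCharacter x

theorem exists_forall_eq_rotPerm_of_isAutomorphism (hbdd : IsBoundedOp (compOp φ hφ))
    (haut : IsAutomorphism (compOp φ hφ)) :
    ∃ (σ : Equiv.Perm (Fin k)) (ε : Fin k → Circle), ∀ z, φ z = rotPerm σ ε (incl z) := by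
  obtain ⟨a, σ, ε, ha, hmobius⟩ := exists_compOp_coord_eq_mobius haut
  obtain ⟨C, hC⟩ := hbdd
  have ha0 (j : Fin k) : a j = 0 := by
    refine eq_zero_of_bddAbove_wienerNorm_pow (ha j) (hmobius j) ⟨C, ?_⟩
    rintro _ ⟨n, rfl⟩
    simpa only [map_pow, wienerNorm_coord_pow, mul_one] using hC (coord j ^ n)
  refine ⟨σ, ε, fun z => Subtype.ext (funext fun j => ?_)⟩
  rw [← coord_apply, ← compOp_apply φ hφ, hmobius, ha0, mobius_zero_left]
  rfl

theorem comp_rotPerm_mem (f : WienerPlus k) (σ : Equiv.Perm (Fin k)) (ε : Fin k → Circle) :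
    f.1 ∘ rotPerm σ ε ∈ WienerPlus k := by
  have he : Function.Injective fun (n : Fin k → ℕ) j => n (σ⁻¹ j) :=
    σ⁻¹.surjective.injective_comp_right
  refine ⟨_, represents_extend he (b := fun n => coeff f n * ∏ j, (ε j : ℂ) ^ n j) ?_ fun z => ?_⟩
  · simpa [Circle.norm_coe] using (represents_coeff f).1
  · have hmon (n : Fin k → ℕ) : monomial n (rotPerm σ ε z) =
        (∏ j, (ε j : ℂ) ^ n j) * monomial (fun j => n (σ⁻¹ j)) z := by
      have hperm : monomial (fun j => n (σ⁻¹ j)) z = ∏ j, z.1 (σ j) ^ n j :=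
        (Equiv.prod_comp σ _).symm.trans (by simp)
      rw [hperm, ← prod_mul_distrib]
      exact prod_congr rfl fun j _ => mul_pow _ _ _
    simpa only [hmon, mul_assoc, Function.comp_apply] using
      (represents_coeff f).2 (rotPerm σ ε z)

theorem isAutomorphism_of_eq_rotPerm {σ : Equiv.Perm (Fin k)} {ε : Fin k → Circle}
    (h : ∀ z, φ z = rotPerm σ ε (incl z)) : IsAutomorphism (compOp φ hφ) := by
  have hcomp (f : WienerPlus k) : (compOp φ hφ f).1 = f.1 ∘ rotPerm σ ε :=
    congrArg Subtype.val (ext_polydisc (g := ⟨_, comp_rotPerm_mem f σ ε⟩) fun z => by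
      rw [compOp_apply, h]; rfl)
  refine ⟨.ofBijective (compOp φ hφ) ⟨fun f g hfg => Subtype.ext ?_, fun g => ?_⟩, rfl⟩
  · exact (rotPerm σ ε).surjective.injective_comp_right
      ((hcomp f).symm.trans ((congrArg Subtype.val hfg).trans (hcomp g)))
  · refine ⟨⟨g.1 ∘ (rotPerm σ ε).symm, comp_rotPerm_mem g σ⁻¹ fun j => (ε (σ⁻¹ j))⁻¹⟩,
      Subtype.ext ((hcomp _).trans ?_)⟩
    exact funext fun z => congrArg g.1 ((rotPerm σ ε).symm_apply_apply z)

end CompositionOperator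

end WienerPlus

theorem theorem3p3 (k : ℕ) (φ : polydisc k → closedPolydisc k)
    (hφ : WienerPlus.MapsIntoSelf φ)
    (hbdd : WienerPlus.IsBoundedOp (WienerPlus.compOp φ hφ)) :
    WienerPlus.IsAutomorphism (WienerPlus.compOp φ hφ) ↔
      ∃ (σ : Equiv.Perm (Fin k)) (ε : Fin k → ℂ), (∀ j, ‖ε j‖ = 1) ∧
        ∀ (z : polydisc k) (j : Fin k), (φ z).1 j = ε j * z.1 (σ j) := by
  constructor
  · intro haut
    obtain ⟨σ, ε, h⟩ := WienerPlus.exists_forall_eq_rotPerm_of_isAutomorphism hbdd haut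
    exact ⟨σ, fun j => ε j, fun j => (ε j).norm_coe,
      fun z j => congrFun (congrArg Subtype.val (h z)) j⟩
  · rintro ⟨σ, ε, hε, h⟩
    exact WienerPlus.isAutomorphism_of_eq_rotPerm
      (ε := fun j => ⟨ε j, mem_sphere_zero_iff_norm.2 (hε j)⟩)
      fun z => Subtype.ext (funext (h z))
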